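/- For $c\in\mathbb R$ let $\mathbb M(c)$ denote the $2$-dimensional (complete, simply connected) space form of constant sectional curvature $c$, that is, the round sphere of radius $1/\sqrt c$ if $c>0$, the Euclidean plane if $c=0$, and the hyperbolic plane of curvature $c$ if $c<0$. Let $c_1,c_2\in\mathbb R$ and let $\mathbb P=\mathbb M(c_1)\times\mathbb M(c_2)$ carry the product metric $\overline g$, its Levi-Civita connection $\nabla^{\mathbb P}$, and the product structure $F(X_1+X_2)=X_1-X_2$ for $X_i$ tangent to the $i$-th factor. Let $M$ be an oriented smooth (immersed) hypersurface of $\mathbb P$, of dimension $3$, with induced metric $g$ and smooth unit normal field $\nu$. Let $E X=-\nabla^{\mathbb P}_X\nu$ be its shape operator and $H=\tfrac13\operatorname{tr}E$ its mean curvature function, and let the tangent vector field $V$ and the function $h$ on $M$ be defined by $F\nu=V+h\nu$. Suppose that $M$ is totally umbilical, i.e. that at every point $E$ is a multiple of the identity. Then $H$ is differentiable, and at every point of $M$ $$\|V\|\,|c_1-c_2|=4\,\|dH\|,$$ where the norms of $V$ and $dH$ are those defined by $g$. -/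

import Mathlib

open scoped Manifold ContDiff

noncomputable section

namespace ProductHypersurface

/-- The ambient vector space `ℝ³` in which each two-dimensional space form is realised. -/
abbrev E3 : Type := Fin 3 → ℝ

/-- The bilinear form on `ℝ³` attached to `c`: the Lorentzian form `-v₀w₀ + v₁w₁ + v₂w₂` if `c < 0`,
the Euclidean form `v₀w₀ + v₁w₁ + v₂w₂` if `0 ≤ c`. -/
def form (c : ℝ) : LinearMap.BilinForm ℝ E3 :=
  LinearMap.mk₂ ℝ
    (fun v w => (if c < 0 then -1 else 1) * v 0 * w 0 + v 1 * w 1 + v 2 * w 2)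
    (fun v v' w => by simp only [Pi.add_apply]; ring)
    (fun a v w => by simp only [Pi.smul_apply, smul_eq_mul]; ring)
    (fun v w w' => by simp only [Pi.add_apply]; ring)
    (fun a v w => by simp only [Pi.smul_apply, smul_eq_mul]; ring)

/-- The simply connected, complete surface of constant sectional curvature `c`, as a surface in `ℝ³`
with the metric induced by `form c`: the round sphere of radius `1 / √c` in Euclidean space if
`0 < c`, the plane `x₀ = 0` in Euclidean space if `c = 0`, and the sheet `0 < x₀` of the
hyperboloid `-x₀² + x₁² + x₂² = 1 / c` in Minkowski space if `c < 0`. -/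
def spaceForm (c : ℝ) : Set E3 :=
  {x | if c = 0 then x 0 = 0 else form c x x = 1 / c ∧ (c < 0 → 0 < x 0)}

/-- A nonzero vector normal to `spaceForm c` at `x`: the position vector if `c ≠ 0`,
the vector `(1, 0, 0)` if `c = 0`. -/
def normalVec (c : ℝ) (x : E3) : E3 :=
  if c = 0 then Pi.single 0 1 else x

/-- The tangent plane of `spaceForm c` at `x`, as a subspace of `ℝ³`. -/
def tangentPlane (c : ℝ) (x : E3) : Submodule ℝ E3 :=
  LinearMap.ker (form c (normalVec c x))

/-- The `form c`-orthogonal projection of `ℝ³` onto the tangent plane of `spaceForm c` at `x`. -/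
def tangentProj (c : ℝ) (x : E3) : E3 →ₗ[ℝ] E3 :=
  LinearMap.id -
    ((form c (normalVec c x) (normalVec c x))⁻¹ • form c (normalVec c x)).smulRight (normalVec c x)

/-- The product metric on (the tangent spaces of) `spaceForm c₁ × spaceForm c₂`. -/
def prodMetric (c₁ c₂ : ℝ) : LinearMap.BilinForm ℝ (E3 × E3) :=
  (form c₁).compl₁₂ (LinearMap.fst ℝ E3 E3) (LinearMap.fst ℝ E3 E3) +
    (form c₂).compl₁₂ (LinearMap.snd ℝ E3 E3) (LinearMap.snd ℝ E3 E3)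

/-- The orthogonal projection onto the tangent space of `spaceForm c₁ × spaceForm c₂` at `p`. The
Levi-Civita covariant derivative of a tangent field along a map into the product is this
projection of the ordinary derivative of the field in `ℝ³ × ℝ³`. -/
def prodProj (c₁ c₂ : ℝ) (p : E3 × E3) : E3 × E3 →ₗ[ℝ] E3 × E3 :=
  (tangentProj c₁ p.1).prodMap (tangentProj c₂ p.2)

/-- The product structure `F (X₁ + X₂) = X₁ - X₂`. -/
def prodStructure : E3 × E3 →ₗ[ℝ] E3 × E3 :=
  (LinearMap.id : E3 →ₗ[ℝ] E3).prodMap (-LinearMap.id)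

/-- An oriented (immersed) smooth hypersurface of `spaceForm c₁ × spaceForm c₂`: a smooth immersion
of a 3-manifold together with a smooth unit normal field. -/
structure Hypersurface (c₁ c₂ : ℝ) (M : Type*) [TopologicalSpace M]
    [ChartedSpace (EuclideanSpace ℝ (Fin 3)) M] where
  /-- the immersion -/
  map : M → E3 × E3
  /-- the unit normal field `ν` along the immersion -/
  normal : M → E3 × E3
  map_mem : ∀ x, map x ∈ spaceForm c₁ ×ˢ spaceForm c₂
  map_smooth : ContMDiff (𝓡 3) 𝓘(ℝ, E3 × E3) ∞ map
  immersion : ∀ x, Function.Injective (mfderiv (𝓡 3) 𝓘(ℝ, E3 × E3) map x)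
  normal_smooth : ContMDiff (𝓡 3) 𝓘(ℝ, E3 × E3) ∞ normal
  normal_tangent : ∀ x,
    (normal x).1 ∈ tangentPlane c₁ (map x).1 ∧ (normal x).2 ∈ tangentPlane c₂ (map x).2
  normal_unit : ∀ x, prodMetric c₁ c₂ (normal x) (normal x) = 1
  normal_orthogonal : ∀ x (X : TangentSpace (𝓡 3) x),
    prodMetric c₁ c₂ (mfderiv (𝓡 3) 𝓘(ℝ, E3 × E3) map x X) (normal x) = 0

namespace Hypersurface

variable {c₁ c₂ : ℝ} {M : Type*} [TopologicalSpace M] [ChartedSpace (EuclideanSpace ℝ (Fin 3)) M]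

/-- The differential of the immersion. -/
def dmap (S : Hypersurface c₁ c₂ M) (x : M) : TangentSpace (𝓡 3) x →ₗ[ℝ] E3 × E3 :=
  (mfderiv (𝓡 3) 𝓘(ℝ, E3 × E3) S.map x).toLinearMap

/-- The derivative of the unit normal field, in `ℝ³ × ℝ³`. -/
def dnormal (S : Hypersurface c₁ c₂ M) (x : M) : TangentSpace (𝓡 3) x →ₗ[ℝ] E3 × E3 :=
  (mfderiv (𝓡 3) 𝓘(ℝ, E3 × E3) S.normal x).toLinearMap

/-- The induced metric `g` on `M`. -/
def metric (S : Hypersurface c₁ c₂ M) (x : M) : LinearMap.BilinForm ℝ (TangentSpace (𝓡 3) x) :=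
  (prodMetric c₁ c₂).compl₁₂ (S.dmap x) (S.dmap x)

/-- The vector of `T_x M` with a given image under the differential of the immersion. It is only
applied to vectors in the range of the (injective) differential, where it is its inverse. -/
def pullback (S : Hypersurface c₁ c₂ M) (x : M) : E3 × E3 →ₗ[ℝ] TangentSpace (𝓡 3) x :=
  (S.dmap x).leftInverse

/-- The shape operator (Weingarten map) `X ↦ -∇_X ν`, where `∇` is the Levi-Civita connection of
`spaceForm c₁ × spaceForm c₂`. -/
def shapeOperator (S : Hypersurface c₁ c₂ M) (x : M) :
    TangentSpace (𝓡 3) x →ₗ[ℝ] TangentSpace (𝓡 3) x :=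
  -(S.pullback x ∘ₗ prodProj c₁ c₂ (S.map x) ∘ₗ S.dnormal x)

/-- The mean curvature `H`, one third of the trace of the shape operator. -/
def meanCurvature (S : Hypersurface c₁ c₂ M) (x : M) : ℝ :=
  LinearMap.trace ℝ (TangentSpace (𝓡 3) x) (S.shapeOperator x) / 3

/-- At every point the shape operator is a multiple of the identity. -/
def IsTotallyUmbilical (S : Hypersurface c₁ c₂ M) : Prop :=
  ∀ x, ∃ a : ℝ, S.shapeOperator x = a • LinearMap.id

/-- The function `h` in the decomposition `F ν = V + h ν`. -/
def h (S : Hypersurface c₁ c₂ M) (x : M) : ℝ :=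
  prodMetric c₁ c₂ (prodStructure (S.normal x)) (S.normal x)

/-- The tangent vector field `V` of `M` in the decomposition `F ν = V + h ν`. -/
def V (S : Hypersurface c₁ c₂ M) (x : M) : TangentSpace (𝓡 3) x :=
  S.pullback x (prodStructure (S.normal x) - S.h x • S.normal x)

/-- The norm of a tangent vector for the induced metric. -/
def tangentNorm (S : Hypersurface c₁ c₂ M) (x : M) (X : TangentSpace (𝓡 3) x) : ℝ :=
  Real.sqrt (S.metric x X X)

/-- The differential at `x` of a real function on `M`. -/
def differential (u : M → ℝ) (x : M) : TangentSpace (𝓡 3) x →ₗ[ℝ] ℝ :=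
  (mfderiv (𝓡 3) 𝓘(ℝ, ℝ) u x).toLinearMap

/-- The norm, for the induced metric, of the differential at `x` of a function on `M`. -/
def diffNorm (S : Hypersurface c₁ c₂ M) (u : M → ℝ) (x : M) : ℝ :=
  sSup {r | ∃ X : TangentSpace (𝓡 3) x, S.tangentNorm x X ≤ 1 ∧
    r = |differential u x X|}

end Hypersurface

end ProductHypersurface

end

/-! Write `f`, `n` for the immersion and its unit normal in a chart, with components `f_i`, `n_i` in
the two copies of `ℝ³`, and put `D_i = df_i` and `θ_i = ⟨D_i ·, n_i⟩`. Umbilicity and the Gauss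
formula of each factor give `dn_i = -H D_i - c_i θ_i f_i`. Since second derivatives are symmetric,
differentiating this once more and antisymmetrising leaves the Codazzi equation `α_i(X) D_i Y =
α_i(Y) D_i X`, where `α_i = dH - c_i θ_i` (`codazzi_of_umbilical`).

If one component of the normal is nonzero, the differential of the other component has rank two, so
the corresponding `α` vanishes (`eq_zero_of_smul_comm`). Thus `n_2 ≠ 0` gives `dH = c₁ θ₁` and `n_1
≠ 0` gives `dH = c₂ θ₂`. Orthogonality to the normal says `θ₁ + θ₂ = 0`, while `g(·, V) = θ₁ - θ₂ =
2 θ₁`. Averaging the two expressions yields `dH = (c₁ - c₂)/4 · g(·, V)`; if one component of the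
normal is zero, both sides vanish (`IsUmbilicalAt.fderiv_eq`). Taking norms of dual one-forms
finishes the proof.

Differentiability of `H` comes first: it is a quotient of smooth functions built from `df` and `dn`
(`IsUmbilicalAt.differentiableAt`). -/

namespace ProductHypersurface

open Filter Topology Module

/-! ### The ambient forms and positivity on tangent planes -/

theorem form_apply (c : ℝ) (v w : E3) :
    form c v w = (if c < 0 then -1 else 1) * v 0 * w 0 + v 1 * w 1 + v 2 * w 2 := rfl

theorem form_comm (c : ℝ) (v w : E3) : form c v w = form c w v := by
  simp only [form_apply]; ring

theorem prodMetric_apply (c₁ c₂ : ℝ) (v w : E3 × E3) :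
    prodMetric c₁ c₂ v w = form c₁ v.1 w.1 + form c₂ v.2 w.2 := rfl

theorem prodMetric_comm (c₁ c₂ : ℝ) (v w : E3 × E3) :
    prodMetric c₁ c₂ v w = prodMetric c₁ c₂ w v := by
  simp only [prodMetric_apply, form_comm _ v.1, form_comm _ v.2]

theorem prodStructure_apply (v : E3 × E3) : prodStructure v = (v.1, -v.2) := rfl

theorem mem_tangentPlane {c : ℝ} {x v : E3} :
    v ∈ tangentPlane c x ↔ form c (normalVec c x) v = 0 := Iff.rfl

theorem form_normalVec_ne_zero {c : ℝ} {x : E3} (hx : x ∈ spaceForm c) :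
    form c (normalVec c x) (normalVec c x) ≠ 0 := by
  by_cases hc : c = 0
  · subst hc
    simp [normalVec, form_apply]
  · simp only [spaceForm, hc, if_false, Set.mem_ofPred_eq] at hx
    simp only [normalVec, hc, if_false, hx.1]
    exact one_div_ne_zero hc

theorem form_self_of_mem {c : ℝ} {x : E3} (hx : x ∈ spaceForm c) (hc : c ≠ 0) :
    form c x x = 1 / c := by
  simp only [spaceForm, hc, if_false, Set.mem_ofPred_eq] at hx
  exact hx.1

/-- The factor `c` absorbs the flat case, where the normal is not the position vector. This lets one
formula serve all signs of `c`. -/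
theorem mul_form_of_mem_tangentPlane {c : ℝ} {x v : E3} (hv : v ∈ tangentPlane c x) :
    c * form c x v = 0 := by
  by_cases hc : c = 0
  · simp [hc]
  · rw [mem_tangentPlane, normalVec, if_neg hc] at hv
    rw [hv, mul_zero]

/-- Only `c < 0` needs an argument: the position vector is timelike, so its orthogonal complement is
spacelike. Concretely, orthogonality and Cauchy–Schwarz bound `(x₀v₀)²` by `(x₁² + x₂²)(v₁² + v₂²)`,
and `x₁² + x₂² < x₀²`. -/
theorem form_pos {c : ℝ} {x v : E3} (hx : x ∈ spaceForm c) (hv : v ∈ tangentPlane c x)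
    (h0 : v ≠ 0) : 0 < form c v v := by
  have key : 0 < v 0 ^ 2 + v 1 ^ 2 + v 2 ^ 2 := by
    by_contra hcon
    apply h0
    have h1 : v 0 = 0 := by nlinarith [sq_nonneg (v 0), sq_nonneg (v 1), sq_nonneg (v 2)]
    have h2 : v 1 = 0 := by nlinarith [sq_nonneg (v 0), sq_nonneg (v 1), sq_nonneg (v 2)]
    have h3 : v 2 = 0 := by nlinarith [sq_nonneg (v 0), sq_nonneg (v 1), sq_nonneg (v 2)]
    ext i
    fin_cases i <;> simp [h1, h2, h3]
  by_cases hc : c < 0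
  · have hs := form_self_of_mem hx hc.ne
    simp only [spaceForm, hc.ne, if_false, Set.mem_ofPred_eq] at hx
    have hx0 := hx.2 hc
    rw [mem_tangentPlane, normalVec, if_neg hc.ne] at hv
    simp only [form_apply, hc, if_true] at hs hv ⊢
    have hneg : 1 / c < 0 := one_div_neg.mpr hc
    have hlt : x 1 ^ 2 + x 2 ^ 2 < x 0 ^ 2 := by nlinarith
    have hcs : (x 0 * v 0) ^ 2 ≤ (x 1 ^ 2 + x 2 ^ 2) * (v 1 ^ 2 + v 2 ^ 2) := by
      have : x 0 * v 0 = x 1 * v 1 + x 2 * v 2 := by linarith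
      rw [this]
      nlinarith [sq_nonneg (x 1 * v 2 - x 2 * v 1)]
    -- Strictness needs a nonzero spatial part; otherwise `x₀v₀ = 0`, and `x₀ > 0` forces `v = 0`.
    have hS : 0 < v 1 ^ 2 + v 2 ^ 2 := by
      rcases (add_nonneg (sq_nonneg (v 1)) (sq_nonneg (v 2))).lt_or_eq with h | h
      · exact h
      · rw [← h, mul_zero] at hcs
        have : x 0 * v 0 = 0 := pow_eq_zero_iff two_ne_zero |>.mp (le_antisymm hcs (sq_nonneg _))
        have hv0 : v 0 = 0 := (mul_eq_zero.mp this).resolve_left hx0.ne'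
        rw [hv0] at key
        linarith
    have : x 0 ^ 2 * v 0 ^ 2 < x 0 ^ 2 * (v 1 ^ 2 + v 2 ^ 2) := by
      nlinarith [mul_lt_mul_of_pos_right hlt hS]
    have := lt_of_mul_lt_mul_left this (sq_nonneg _)
    linarith
  · simp only [form_apply, hc, if_false]
    linarith

theorem form_nonneg {c : ℝ} {x v : E3} (hx : x ∈ spaceForm c) (hv : v ∈ tangentPlane c x) :
    0 ≤ form c v v := by
  rcases eq_or_ne v 0 with rfl | h
  · simp
  · exact (form_pos hx hv h).le

theorem tangentProj_mem {c : ℝ} {x : E3} (hx : x ∈ spaceForm c) (w : E3) :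
    tangentProj c x w ∈ tangentPlane c x := by
  have h := form_normalVec_ne_zero hx
  rw [mem_tangentPlane]
  change form c (normalVec c x) (w - ((form c (normalVec c x) (normalVec c x))⁻¹ *
    form c (normalVec c x) w) • normalVec c x) = 0
  rw [map_sub, map_smul, smul_eq_mul]
  field_simp
  ring

/-! ### Dimension counts -/

theorem finrank_inf_ker_lt {W : Type*} [AddCommGroup W] [Module ℝ W] [FiniteDimensional ℝ W]
    (K : Submodule ℝ W) (α : W →ₗ[ℝ] ℝ) {v : W} (hv : v ∈ K) (hα : α v ≠ 0) :
    finrank ℝ (K ⊓ LinearMap.ker α : Submodule ℝ W) < finrank ℝ K := by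
  apply Submodule.finrank_lt_finrank_of_lt
  refine lt_of_le_of_ne inf_le_left fun h => hα ?_
  rw [← h] at hv
  exact hv.2

theorem finrank_tangentPlane_le {c : ℝ} {x : E3} (hx : x ∈ spaceForm c) :
    finrank ℝ (tangentPlane c x) ≤ 2 := by
  have := finrank_inf_ker_lt ⊤ (form c (normalVec c x)) (v := normalVec c x) trivial
    (form_normalVec_ne_zero hx)
  rw [top_inf_eq, finrank_top] at this
  simp only [E3, Module.finrank_fin_fun] at this
  exact Nat.lt_succ_iff.mp this

/-- If the image of an injective map of a three-dimensional space into the tangent space of the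
product is orthogonal to a vector with nonzero first component, then its second component has rank
two, hence does not divide any nonzero linear form. -/
theorem eq_zero_of_smul_comm {c₁ c₂ : ℝ} {x₁ ν₁ ν₂ : E3} (hx : x₁ ∈ spaceForm c₁)
    (hν : ν₁ ∈ tangentPlane c₁ x₁) (h0 : ν₁ ≠ 0)
    {T : Type*} [AddCommGroup T] [Module ℝ T] [FiniteDimensional ℝ T] (hT : finrank ℝ T = 3)
    (D₁ D₂ : T →ₗ[ℝ] E3) (hinj : ∀ X, D₁ X = 0 → D₂ X = 0 → X = 0)
    (htan : ∀ X, D₁ X ∈ tangentPlane c₁ x₁)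
    (horth : ∀ X, form c₁ (D₁ X) ν₁ + form c₂ (D₂ X) ν₂ = 0)
    (α : T →ₗ[ℝ] ℝ) (hα : ∀ X Y, α X • D₂ Y = α Y • D₂ X) : α = 0 := by
  by_contra hne
  obtain ⟨Z, hZ⟩ : ∃ Z, α Z ≠ 0 := by
    by_contra! h
    exact hne (LinearMap.ext h)
  -- On the kernel of a nonzero `α`, of dimension two, `D₂` vanishes. So `D₁` embeds that kernel
  -- into the part of a tangent plane orthogonal to `ν₁`, which is at most a line.
  have h2 : ∀ X ∈ LinearMap.ker α, D₂ X = 0 := fun X hX => by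
    have := hα Z X
    rw [LinearMap.mem_ker.mp hX, zero_smul] at this
    exact (smul_eq_zero.mp this).resolve_left hZ
  have h1 : ∀ X ∈ LinearMap.ker α, D₁ X ∈ tangentPlane c₁ x₁ ⊓ LinearMap.ker (form c₁ ν₁) :=
    fun X hX => ⟨htan X, by
      have := horth X
      rw [h2 X hX, map_zero, LinearMap.zero_apply, add_zero, form_comm] at this
      exact this⟩
  have hinj' : Function.Injective (D₁.restrict h1) := by
    rw [← LinearMap.ker_eq_bot, LinearMap.ker_eq_bot']
    intro X hX
    have : D₁ X = 0 := congrArg Subtype.val hX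
    exact Subtype.ext (hinj X this (h2 X X.2))
  have e1 := LinearMap.finrank_le_finrank_of_injective hinj'
  have e2 := finrank_inf_ker_lt (tangentPlane c₁ x₁) (form c₁ ν₁) hν (form_pos hx hν h0).ne'
  have e3 := finrank_tangentPlane_le hx
  have e4 := LinearMap.finrank_range_add_finrank_ker α
  have e5 := Submodule.finrank_le (LinearMap.range α)
  rw [Module.finrank_self] at e5
  omega

/-- The orthogonal complement of a unit vector in the tangent space of the product is the range of
any injective map of a three-dimensional space into it. -/
theorem mem_range_of_orthogonal {c₁ c₂ : ℝ} {x ν : E3 × E3}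
    (hx : x ∈ spaceForm c₁ ×ˢ spaceForm c₂)
    (hν : ν.1 ∈ tangentPlane c₁ x.1 ∧ ν.2 ∈ tangentPlane c₂ x.2) (hu : prodMetric c₁ c₂ ν ν = 1)
    {T : Type*} [AddCommGroup T] [Module ℝ T] [FiniteDimensional ℝ T] (hT : finrank ℝ T = 3)
    (D : T →ₗ[ℝ] E3 × E3) (hinj : Function.Injective D)
    (htan : ∀ X, (D X).1 ∈ tangentPlane c₁ x.1 ∧ (D X).2 ∈ tangentPlane c₂ x.2)
    (horth : ∀ X, prodMetric c₁ c₂ (D X) ν = 0) {w : E3 × E3}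
    (hw : w.1 ∈ tangentPlane c₁ x.1 ∧ w.2 ∈ tangentPlane c₂ x.2)
    (hwν : prodMetric c₁ c₂ w ν = 0) : w ∈ LinearMap.range D := by
  set P := (tangentPlane c₁ x.1).prod (tangentPlane c₂ x.2)
  set K := P ⊓ LinearMap.ker (prodMetric c₁ c₂ ν)
  have hK : finrank ℝ K < finrank ℝ P := finrank_inf_ker_lt P _ hν (by rw [hu]; exact one_ne_zero)
  have hP : finrank ℝ P ≤ 4 := by
    have e := LinearMap.finrank_range_le
      ((tangentPlane c₁ x.1).subtype.prodMap (tangentPlane c₂ x.2).subtype)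
    rw [LinearMap.range_prodMap, Submodule.range_subtype, Submodule.range_subtype,
      Module.finrank_prod] at e
    change finrank ℝ P ≤ _ at e
    have := finrank_tangentPlane_le hx.1
    have := finrank_tangentPlane_le hx.2
    omega
  have hle : LinearMap.range D ≤ K := by
    rintro _ ⟨X, rfl⟩
    exact ⟨htan X, (prodMetric_comm ..).trans (horth X)⟩
  have hr : finrank ℝ (LinearMap.range D) = 3 := by rw [LinearMap.finrank_range_of_inj hinj, hT]
  -- The range has dimension 3 and lies in `K`, whose dimension is below that of `P`, hence at most
  -- 3.
  rw [Submodule.eq_of_le_of_finrank_le hle (by omega)]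
  exact ⟨hw, (prodMetric_comm ..).trans hwν⟩

/-! ### Gauss and Codazzi equations in one factor -/

section Calculus

variable {E : Type*} [NormedAddCommGroup E] [NormedSpace ℝ E]

theorem hasFDerivAt_form {c : ℝ} {u v : E → E3} {u' v' : E →L[ℝ] E3} {y : E}
    (hu : HasFDerivAt u u' y) (hv : HasFDerivAt v v' y) :
    ∃ w' : E →L[ℝ] ℝ, HasFDerivAt (fun z => form c (u z) (v z)) w' y ∧
      ∀ X, w' X = form c (u' X) (v y) + form c (u y) (v' X) := by
  refine ⟨_, (form c).toContinuousBilinearMap.hasFDerivAt_of_bilinear hu hv, fun X => ?_⟩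
  exact add_comm _ _

theorem fderiv_mem_tangentPlane {c : ℝ} {f : E → E3} {y : E} (hf : DifferentiableAt ℝ f y)
    (hmem : ∀ᶠ z in 𝓝 y, f z ∈ spaceForm c) (X : E) :
    fderiv ℝ f y X ∈ tangentPlane c (f y) := by
  rw [mem_tangentPlane]
  by_cases hc : c = 0
  · subst hc
    have h0 : (fun z => f z 0) =ᶠ[𝓝 y] fun _ => (0 : ℝ) := by
      filter_upwards [hmem] with z hz
      simpa [spaceForm] using hz
    have h1 := (hasFDerivAt_pi'.mp hf.hasFDerivAt) 0
    have h2 := h1.unique ((hasFDerivAt_const (0 : ℝ) y).congr_of_eventuallyEq h0)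
    have h3 : fderiv ℝ f y X 0 = 0 := congrArg (fun L : E →L[ℝ] ℝ => L X) h2
    simp [normalVec, form_apply, h3]
  · obtain ⟨w', hw, hX⟩ := hasFDerivAt_form (c := c) hf.hasFDerivAt hf.hasFDerivAt
    have h0 : (fun z => form c (f z) (f z)) =ᶠ[𝓝 y] fun _ => 1 / c := by
      filter_upwards [hmem] with z hz using form_self_of_mem hz hc
    have h2 := hw.unique ((hasFDerivAt_const (1 / c) y).congr_of_eventuallyEq h0)
    have h3 := hX X
    rw [h2, form_comm c (fderiv ℝ f y X)] at h3
    simp only [zero_apply] at h3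
    rw [normalVec, if_neg hc]
    linarith

/-- Differentiating `⟨f, n⟩ = 0` gives `⟨f, dn⟩ = -⟨df, n⟩`, and `⟨f, f⟩⁻¹ = c` turns this into the
normal part. For `c = 0` the correction vanishes, since `dn` stays in the plane. -/
theorem tangentProj_fderiv {c : ℝ} {f n : E → E3} {y : E} (hf : DifferentiableAt ℝ f y)
    (hn : DifferentiableAt ℝ n y) (hmem : f y ∈ spaceForm c)
    (htan : ∀ᶠ z in 𝓝 y, n z ∈ tangentPlane c (f z)) (X : E) :
    tangentProj c (f y) (fderiv ℝ n y X) =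
      fderiv ℝ n y X + (c * form c (fderiv ℝ f y X) (n y)) • f y := by
  change fderiv ℝ n y X - ((form c (normalVec c (f y)) (normalVec c (f y)))⁻¹ *
    form c (normalVec c (f y)) (fderiv ℝ n y X)) • normalVec c (f y) = _
  by_cases hc : c = 0
  · subst hc
    have h0 : (fun z => n z 0) =ᶠ[𝓝 y] fun _ => (0 : ℝ) := by
      filter_upwards [htan] with z hz
      simpa [mem_tangentPlane, normalVec, form_apply] using hz
    have h1 := (hasFDerivAt_pi'.mp hn.hasFDerivAt) 0
    have h2 := h1.unique ((hasFDerivAt_const (0 : ℝ) y).congr_of_eventuallyEq h0)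
    have h3 : fderiv ℝ n y X 0 = 0 := congrArg (fun L : E →L[ℝ] ℝ => L X) h2
    simp [normalVec, form_apply, h3]
  · obtain ⟨w', hw, hX⟩ := hasFDerivAt_form (c := c) hf.hasFDerivAt hn.hasFDerivAt
    have h0 : (fun z => form c (f z) (n z)) =ᶠ[𝓝 y] fun _ => (0 : ℝ) := by
      filter_upwards [htan] with z hz
      rwa [mem_tangentPlane, normalVec, if_neg hc] at hz
    have h2 := hw.unique ((hasFDerivAt_const (0 : ℝ) y).congr_of_eventuallyEq h0)
    have h3 := hX X
    rw [h2, zero_apply] at h3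
    have h4 : form c (f y) (fderiv ℝ n y X) = -form c (fderiv ℝ f y X) (n y) := by linarith
    rw [normalVec, if_neg hc, h4, form_self_of_mem hmem hc, one_div, inv_inv, mul_neg, neg_smul,
      sub_neg_eq_add]

theorem hasFDerivAt_fderiv_apply {W : Type*} [NormedAddCommGroup W] [NormedSpace ℝ W] {f : E → W}
    {y : E} (hf : ContDiffAt ℝ 2 f y) (X : E) :
    HasFDerivAt (fun z => fderiv ℝ f z X) ((fderiv ℝ (fderiv ℝ f) y).flip X) y := by
  have h : DifferentiableAt ℝ (fderiv ℝ f) y :=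
    (hf.fderiv_right (m := 1) (by norm_num)).differentiableAt one_ne_zero
  exact ((ContinuousLinearMap.apply ℝ W X).hasFDerivAt.comp y h.hasFDerivAt)

/-- The Codazzi equation of a totally umbilical hypersurface of a product of two space forms,
projected onto one of the factors. -/
theorem codazzi_of_umbilical {c : ℝ} {f n : E → E3} {a : E → ℝ} {y : E}
    (hf : ContDiffAt ℝ 2 f y) (hn : ContDiffAt ℝ 2 n y) (ha : DifferentiableAt ℝ a y)
    (hmem : ∀ᶠ z in 𝓝 y, f z ∈ spaceForm c)
    (hder : ∀ᶠ z in 𝓝 y, ∀ X, fderiv ℝ n z X =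
      -(a z • fderiv ℝ f z X) - (c * form c (fderiv ℝ f z X) (n z)) • f z) (X Y : E) :
    (fderiv ℝ a y X - c * form c (fderiv ℝ f y X) (n y)) • fderiv ℝ f y Y =
      (fderiv ℝ a y Y - c * form c (fderiv ℝ f y Y) (n y)) • fderiv ℝ f y X := by
  have hf1 := hf.differentiableAt two_ne_zero
  have hn1 := hn.differentiableAt two_ne_zero
  -- Derivative of `hder` in the direction `Y`. All terms are symmetric in `X` and `Y` except those
  -- with `da` and with `⟨df X, n⟩ df Y`; these survive antisymmetrisation.
  have key : ∀ X Y, fderiv ℝ (fderiv ℝ n) y Y X =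
      -(fderiv ℝ a y Y • fderiv ℝ f y X) - a y • fderiv ℝ (fderiv ℝ f) y Y X
        - (c * form c (fderiv ℝ (fderiv ℝ f) y Y X) (n y)
          - a y * (c * form c (fderiv ℝ f y X) (fderiv ℝ f y Y))) • f y
        - (c * form c (fderiv ℝ f y X) (n y)) • fderiv ℝ f y Y := by
    intro X Y
    have hF := hasFDerivAt_fderiv_apply hf X
    have hN := hasFDerivAt_fderiv_apply hn X
    obtain ⟨w', hw, hw'⟩ := hasFDerivAt_form (c := c) hF hn1.hasFDerivAt
    have hR := ((ha.hasFDerivAt.smul hF).neg.sub ((hw.const_mul c).smul hf1.hasFDerivAt))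
    have h2 := hN.unique (hR.congr_of_eventuallyEq (hder.mono fun z hz => hz X))
    have h3 := congrArg (fun L : E →L[ℝ] E3 => L Y) h2
    -- Substituting `hder` for `dn` inside the form produces a multiple of `⟨df X, f⟩`, which
    -- tangency removes.
    have h4 : c * form c (fderiv ℝ f y X) (f y) = 0 := by
      rw [form_comm]
      exact mul_form_of_mem_tangentPlane (fderiv_mem_tangentPlane hf1 hmem X)
    simp only [ContinuousLinearMap.flip_apply, sub_apply,
      neg_apply, add_apply,
      smul_apply, ContinuousLinearMap.smulRight_apply, hw',
      hder.self_of_nhds Y, map_sub, map_neg, map_smul, smul_eq_mul] at h3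
    rw [h3]
    have h5 : c * (form c (fderiv ℝ (fderiv ℝ f) y Y X) (n y) +
        (-(a y * form c (fderiv ℝ f y X) (fderiv ℝ f y Y)) -
          c * form c (fderiv ℝ f y Y) (n y) * form c (fderiv ℝ f y X) (f y))) =
        c * form c (fderiv ℝ (fderiv ℝ f) y Y X) (n y)
          - a y * (c * form c (fderiv ℝ f y X) (fderiv ℝ f y Y)) := by
      linear_combination (-(c * form c (fderiv ℝ f y Y) (n y))) * h4
    rw [h5]
    module
  have hs : ∀ {g : E → E3}, ContDiffAt ℝ 2 g y →
      fderiv ℝ (fderiv ℝ g) y Y X = fderiv ℝ (fderiv ℝ g) y X Y := fun hg =>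
    hg.isSymmSndFDerivAt (by simp) Y X
  have e1 := key X Y
  have e2 := key Y X
  rw [hs hn, hs hf, e2, form_comm c (fderiv ℝ f y Y) (fderiv ℝ f y X)] at e1
  linear_combination (norm := module) (-1 : ℝ) • e1

end Calculus

/-! ### Parametrised umbilical hypersurfaces -/

section Local

variable {E : Type*} [NormedAddCommGroup E] [NormedSpace ℝ E]

theorem fderiv_fst_apply {f : E → E3 × E3} {z : E} (hf : DifferentiableAt ℝ f z) (X : E) :
    fderiv ℝ (fun z => (f z).1) z X = (fderiv ℝ f z X).1 := by
  rw [fderiv.fst hf]; rfl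

theorem fderiv_snd_apply {f : E → E3 × E3} {z : E} (hf : DifferentiableAt ℝ f z) (X : E) :
    fderiv ℝ (fun z => (f z).2) z X = (fderiv ℝ f z X).2 := by
  rw [fderiv.snd hf]; rfl

/-- A parametrised totally umbilical hypersurface of the product, near a point, with principal
curvature `a`. -/
structure IsUmbilicalAt (c₁ c₂ : ℝ) (f n : E → E3 × E3) (a : E → ℝ) (z : E) : Prop where
  contDiffAt_map : ContDiffAt ℝ 2 f z
  contDiffAt_normal : ContDiffAt ℝ 2 n z
  mem : f z ∈ spaceForm c₁ ×ˢ spaceForm c₂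
  injective : Function.Injective (fderiv ℝ f z)
  tangent : (n z).1 ∈ tangentPlane c₁ (f z).1 ∧ (n z).2 ∈ tangentPlane c₂ (f z).2
  unit : prodMetric c₁ c₂ (n z) (n z) = 1
  orthogonal : ∀ X, prodMetric c₁ c₂ (fderiv ℝ f z X) (n z) = 0
  umbilical : ∀ X, prodProj c₁ c₂ (f z) (fderiv ℝ n z X) = -(a z • fderiv ℝ f z X)

theorem prodMetric_pos {c₁ c₂ : ℝ} {x v : E3 × E3} (hx : x ∈ spaceForm c₁ ×ˢ spaceForm c₂)
    (hv : v.1 ∈ tangentPlane c₁ x.1 ∧ v.2 ∈ tangentPlane c₂ x.2) (h0 : v ≠ 0) :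
    0 < prodMetric c₁ c₂ v v := by
  rw [prodMetric_apply]
  by_cases h1 : v.1 = 0
  · have h2 : v.2 ≠ 0 := fun h2 => h0 (Prod.ext h1 h2)
    exact add_pos_of_nonneg_of_pos (form_nonneg hx.1 hv.1) (form_pos hx.2 hv.2 h2)
  · exact add_pos_of_pos_of_nonneg (form_pos hx.1 hv.1 h1) (form_nonneg hx.2 hv.2)

variable {c₁ c₂ : ℝ} {f n : E → E3 × E3} {a : E → ℝ} {y : E}

theorem fderiv_tangent (hf : DifferentiableAt ℝ f y)
    (hmem : ∀ᶠ z in 𝓝 y, f z ∈ spaceForm c₁ ×ˢ spaceForm c₂) (X : E) :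
    (fderiv ℝ f y X).1 ∈ tangentPlane c₁ (f y).1 ∧
      (fderiv ℝ f y X).2 ∈ tangentPlane c₂ (f y).2 := by
  rw [← fderiv_fst_apply hf, ← fderiv_snd_apply hf]
  exact ⟨fderiv_mem_tangentPlane hf.fst (hmem.mono fun z hz => hz.1) X,
    fderiv_mem_tangentPlane hf.snd (hmem.mono fun z hz => hz.2) X⟩

theorem prodProj_fderiv (hf : DifferentiableAt ℝ f y) (hn : DifferentiableAt ℝ n y)
    (hmem : f y ∈ spaceForm c₁ ×ˢ spaceForm c₂)
    (htan : ∀ᶠ z in 𝓝 y, (n z).1 ∈ tangentPlane c₁ (f z).1 ∧ (n z).2 ∈ tangentPlane c₂ (f z).2)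
    (X : E) :
    prodProj c₁ c₂ (f y) (fderiv ℝ n y X) =
      ((fderiv ℝ n y X).1 + (c₁ * form c₁ (fderiv ℝ f y X).1 (n y).1) • (f y).1,
        (fderiv ℝ n y X).2 + (c₂ * form c₂ (fderiv ℝ f y X).2 (n y).2) • (f y).2) := by
  have h1 := tangentProj_fderiv hf.fst hn.fst hmem.1 (htan.mono fun z hz => hz.1) X
  have h2 := tangentProj_fderiv hf.snd hn.snd hmem.2 (htan.mono fun z hz => hz.2) X
  rw [fderiv_fst_apply hf, fderiv_fst_apply hn] at h1
  rw [fderiv_snd_apply hf, fderiv_snd_apply hn] at h2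
  exact Prod.ext h1 h2

/-- The projection adds only multiples of `c_i f_i` to the components, and these pair to zero with
tangent vectors. -/
theorem prodMetric_prodProj_fderiv_normal (hf : DifferentiableAt ℝ f y)
    (hn : DifferentiableAt ℝ n y) (hmem : f y ∈ spaceForm c₁ ×ˢ spaceForm c₂)
    (htan : ∀ᶠ z in 𝓝 y, (n z).1 ∈ tangentPlane c₁ (f z).1 ∧ (n z).2 ∈ tangentPlane c₂ (f z).2)
    (X : E) {w : E3 × E3} (hw : w.1 ∈ tangentPlane c₁ (f y).1 ∧ w.2 ∈ tangentPlane c₂ (f y).2) :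
    prodMetric c₁ c₂ (prodProj c₁ c₂ (f y) (fderiv ℝ n y X)) w =
      prodMetric c₁ c₂ (fderiv ℝ n y X) w := by
  rw [prodProj_fderiv hf hn hmem htan]
  simp only [prodMetric_apply, map_add, LinearMap.add_apply, map_smul, LinearMap.smul_apply,
    smul_eq_mul]
  linear_combination form c₁ (fderiv ℝ f y X).1 (n y).1 * mul_form_of_mem_tangentPlane hw.1 +
    form c₂ (fderiv ℝ f y X).2 (n y).2 * mul_form_of_mem_tangentPlane hw.2

theorem prodMetric_fderiv_normal_self (hn : DifferentiableAt ℝ n y)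
    (hu : ∀ᶠ z in 𝓝 y, prodMetric c₁ c₂ (n z) (n z) = 1) (X : E) :
    prodMetric c₁ c₂ (fderiv ℝ n y X) (n y) = 0 := by
  obtain ⟨w₁, hw₁, hX₁⟩ := hasFDerivAt_form (c := c₁) hn.fst.hasFDerivAt hn.fst.hasFDerivAt
  obtain ⟨w₂, hw₂, hX₂⟩ := hasFDerivAt_form (c := c₂) hn.snd.hasFDerivAt hn.snd.hasFDerivAt
  have h := (hw₁.add hw₂).unique ((hasFDerivAt_const (1 : ℝ) y).congr_of_eventuallyEq hu)
  have h' := congrArg (fun L : E →L[ℝ] ℝ => L X) h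
  simp only [add_apply, zero_apply, hX₁, hX₂, fderiv_fst_apply hn, fderiv_snd_apply hn] at h'
  rw [prodMetric_apply]
  rw [form_comm c₁ (n y).1, form_comm c₂ (n y).2] at h'
  linarith

/-- No regularity of `a` is assumed. Pairing the umbilicity equation with `df X`, for one fixed `X ≠
0`, gives `a = -⟨dn X, df X⟩ / ⟨df X, df X⟩`, whose denominator is positive because `df` is
injective. -/
theorem IsUmbilicalAt.differentiableAt [Nontrivial E]
    (h : ∀ᶠ z in 𝓝 y, IsUmbilicalAt c₁ c₂ f n a z) : DifferentiableAt ℝ a y := by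
  obtain ⟨X, hX⟩ := exists_ne (0 : E)
  have hy := h.self_of_nhds
  have hDf := hasFDerivAt_fderiv_apply hy.contDiffAt_map X
  have hDn := hasFDerivAt_fderiv_apply hy.contDiffAt_normal X
  obtain ⟨q₁, hq₁, -⟩ := hasFDerivAt_form (c := c₁) hDf.fst hDf.fst
  obtain ⟨q₂, hq₂, -⟩ := hasFDerivAt_form (c := c₂) hDf.snd hDf.snd
  obtain ⟨r₁, hr₁, -⟩ := hasFDerivAt_form (c := c₁) hDn.fst hDf.fst
  obtain ⟨r₂, hr₂, -⟩ := hasFDerivAt_form (c := c₂) hDn.snd hDf.snd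
  have hpos : ∀ᶠ z in 𝓝 y, 0 < prodMetric c₁ c₂ (fderiv ℝ f z X) (fderiv ℝ f z X) := by
    filter_upwards [h.eventually_nhds] with z hz
    have hz0 := hz.self_of_nhds
    refine prodMetric_pos hz0.mem (fderiv_tangent (hz0.contDiffAt_map.differentiableAt two_ne_zero)
      (hz.mono fun w hw => hw.mem) X) fun h0 => hX (hz0.injective ?_)
    rw [h0, map_zero]
  have heq : a =ᶠ[𝓝 y] fun z => -prodMetric c₁ c₂ (fderiv ℝ n z X) (fderiv ℝ f z X) /
      prodMetric c₁ c₂ (fderiv ℝ f z X) (fderiv ℝ f z X) := by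
    filter_upwards [h.eventually_nhds, hpos] with z hz hp
    have hz0 := hz.self_of_nhds
    have hfz := hz0.contDiffAt_map.differentiableAt two_ne_zero
    have e := prodMetric_prodProj_fderiv_normal hfz
      (hz0.contDiffAt_normal.differentiableAt two_ne_zero) hz0.mem
      (hz.mono fun w hw => hw.tangent) X (fderiv_tangent hfz (hz.mono fun w hw => hw.mem) X)
    rw [hz0.umbilical X] at e
    simp only [map_neg, LinearMap.neg_apply, map_smul, LinearMap.smul_apply, smul_eq_mul] at e
    rw [eq_div_iff hp.ne', ← e, neg_neg]
  have hr : DifferentiableAt ℝ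
      (fun z => prodMetric c₁ c₂ (fderiv ℝ n z X) (fderiv ℝ f z X)) y :=
    (hr₁.add hr₂).differentiableAt
  have hq : DifferentiableAt ℝ
      (fun z => prodMetric c₁ c₂ (fderiv ℝ f z X) (fderiv ℝ f z X)) y :=
    (hq₁.add hq₂).differentiableAt
  have hne := hpos.self_of_nhds.ne'
  simp only [div_eq_mul_inv] at heq
  exact (hr.fun_neg.fun_mul (hq.fun_inv hne)).congr_of_eventuallyEq heq

/-- The differential of the principal curvature of a totally umbilical hypersurface of a product of
two surfaces of constant curvature. -/
theorem IsUmbilicalAt.fderiv_eq (hE : finrank ℝ E = 3)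
    (h : ∀ᶠ z in 𝓝 y, IsUmbilicalAt c₁ c₂ f n a z) (X : E) :
    fderiv ℝ a y X =
      (c₁ - c₂) / 4 * prodMetric c₁ c₂ (fderiv ℝ f y X) (prodStructure (n y)) := by
  have hfin : FiniteDimensional ℝ E := FiniteDimensional.of_finrank_pos (by omega)
  have : Nontrivial E := Module.nontrivial_of_finrank_pos (R := ℝ) (by omega)
  have ha := IsUmbilicalAt.differentiableAt h
  have hy := h.self_of_nhds
  have hf1 := hy.contDiffAt_map.differentiableAt two_ne_zero
  have hder : ∀ᶠ z in 𝓝 y, ∀ X,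
      (fderiv ℝ (fun z => (n z).1) z X = -(a z • fderiv ℝ (fun z => (f z).1) z X)
        - (c₁ * form c₁ (fderiv ℝ (fun z => (f z).1) z X) (n z).1) • (f z).1) ∧
      (fderiv ℝ (fun z => (n z).2) z X = -(a z • fderiv ℝ (fun z => (f z).2) z X)
        - (c₂ * form c₂ (fderiv ℝ (fun z => (f z).2) z X) (n z).2) • (f z).2) := by
    filter_upwards [h.eventually_nhds] with z hz X
    have hz0 := hz.self_of_nhds
    have hfz := hz0.contDiffAt_map.differentiableAt two_ne_zero
    have hnz := hz0.contDiffAt_normal.differentiableAt two_ne_zero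
    have e := (prodProj_fderiv hfz hnz hz0.mem (hz.mono fun w hw => hw.tangent) X).symm.trans
      (hz0.umbilical X)
    simp only [fderiv_fst_apply hfz, fderiv_fst_apply hnz, fderiv_snd_apply hfz,
      fderiv_snd_apply hnz]
    exact ⟨eq_sub_of_add_eq (congrArg Prod.fst e), eq_sub_of_add_eq (congrArg Prod.snd e)⟩
  have k1 := codazzi_of_umbilical hy.contDiffAt_map.fst hy.contDiffAt_normal.fst ha
    (h.mono fun z hz => hz.mem.1) (hder.mono fun z hz X => (hz X).1)
  have k2 := codazzi_of_umbilical hy.contDiffAt_map.snd hy.contDiffAt_normal.snd ha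
    (h.mono fun z hz => hz.mem.2) (hder.mono fun z hz X => (hz X).2)
  simp only [fderiv_fst_apply hf1] at k1
  simp only [fderiv_snd_apply hf1] at k2
  set D : E →ₗ[ℝ] E3 × E3 := (fderiv ℝ f y).toLinearMap
  set D₁ : E →ₗ[ℝ] E3 := LinearMap.fst ℝ E3 E3 ∘ₗ D
  set D₂ : E →ₗ[ℝ] E3 := LinearMap.snd ℝ E3 E3 ∘ₗ D
  have htan := fderiv_tangent hf1 (h.mono fun z hz => hz.mem)
  have hinj : ∀ X, D₁ X = 0 → D₂ X = 0 → X = 0 := fun X h1 h2 =>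
    hy.injective ((Prod.ext h1 h2).trans (map_zero _).symm)
  have horth : ∀ X, form c₁ (D₁ X) (n y).1 + form c₂ (D₂ X) (n y).2 = 0 := hy.orthogonal
  -- The rank lemma is used with the factors exchanged: `n₂ ≠ 0` makes `D₁` of rank two, which kills
  -- `α₁`.
  have r1 : (n y).2 ≠ 0 → fderiv ℝ a y X = c₁ * form c₁ (D₁ X) (n y).1 := fun h0 => by
    have := eq_zero_of_smul_comm hy.mem.2 hy.tangent.2 h0 hE D₂ D₁ (fun X h1 h2 => hinj X h2 h1)
      (fun X => (htan X).2) (fun X => (add_comm _ _).trans (horth X))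
      ((fderiv ℝ a y).toLinearMap - c₁ • (form c₁ (n y).1 ∘ₗ D₁)) (fun X Y => by
        have := k1 X Y
        rw [form_comm, form_comm c₁ (fderiv ℝ f y Y).1] at this
        exact this)
    rw [form_comm]
    exact sub_eq_zero.mp (LinearMap.congr_fun this X)
  have r2 : (n y).1 ≠ 0 → fderiv ℝ a y X = c₂ * form c₂ (D₂ X) (n y).2 := fun h0 => by
    have := eq_zero_of_smul_comm hy.mem.1 hy.tangent.1 h0 hE D₁ D₂ hinj
      (fun X => (htan X).1) horth
      ((fderiv ℝ a y).toLinearMap - c₂ • (form c₂ (n y).2 ∘ₗ D₂)) (fun X Y => by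
        have := k2 X Y
        rw [form_comm, form_comm c₂ (fderiv ℝ f y Y).2] at this
        exact this)
    rw [form_comm]
    exact sub_eq_zero.mp (LinearMap.congr_fun this X)
  have hθ : prodMetric c₁ c₂ (fderiv ℝ f y X) (prodStructure (n y)) =
      form c₁ (D₁ X) (n y).1 - form c₂ (D₂ X) (n y).2 := by
    rw [prodMetric_apply, prodStructure_apply, map_neg]
    rfl
  have ho := horth X
  rw [hθ]
  -- The components of a unit normal cannot both vanish. If exactly one does, its `θ` is zero, hence
  -- so is the other, and `dH = 0`.
  by_cases h1 : (n y).1 = 0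
  · by_cases h2 : (n y).2 = 0
    · have hu := hy.unit
      rw [show n y = 0 from Prod.ext h1 h2, map_zero] at hu
      exact absurd hu zero_ne_one
    · rw [r1 h2]
      rw [h1, map_zero] at ho ⊢
      rw [zero_add] at ho
      rw [ho]
      ring
  · by_cases h2 : (n y).2 = 0
    · rw [r2 h1]
      rw [h2, map_zero] at ho ⊢
      rw [add_zero] at ho
      rw [ho]
      ring
    -- Here `dH = c₁ θ₁ = -c₂ θ₁`; the claim is the mean of the two, with `θ₁ - θ₂ = 2 θ₁`.
    · have e1 := r1 h2
      have e2 := r2 h1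
      rw [show form c₂ (D₂ X) (n y).2 = -form c₁ (D₁ X) (n y).1 by linarith] at e2 ⊢
      linarith

end Local

/-! ### Passage from the manifold to charts -/

namespace Hypersurface

variable {c₁ c₂ : ℝ} {M : Type*} [TopologicalSpace M] [ChartedSpace (EuclideanSpace ℝ (Fin 3)) M]

theorem finrank_tangentSpace (x : M) : finrank ℝ (TangentSpace (𝓡 3) x) = 3 :=
  finrank_euclideanSpace_fin (𝕜 := ℝ) (n := 3)

instance (x : M) : FiniteDimensional ℝ (TangentSpace (𝓡 3) x) :=
  inferInstanceAs (FiniteDimensional ℝ (EuclideanSpace ℝ (Fin 3)))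

theorem dmap_injective (S : Hypersurface c₁ c₂ M) (x : M) : Function.Injective (S.dmap x) :=
  S.immersion x

theorem pullback_dmap (S : Hypersurface c₁ c₂ M) (x : M) (X : TangentSpace (𝓡 3) x) :
    S.pullback x (S.dmap x X) = X :=
  LinearMap.leftInverse_apply_of_inj (LinearMap.ker_eq_bot.mpr (S.dmap_injective x)) X

theorem dmap_pullback (S : Hypersurface c₁ c₂ M) (x : M) {w : E3 × E3}
    (hw : w ∈ LinearMap.range (S.dmap x)) : S.dmap x (S.pullback x w) = w := by
  obtain ⟨X, rfl⟩ := hw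
  rw [pullback_dmap]

theorem meanCurvature_eq (S : Hypersurface c₁ c₂ M) {x : M} {a : ℝ}
    (ha : S.shapeOperator x = a • LinearMap.id) : S.meanCurvature x = a := by
  rw [meanCurvature, ha, map_smul, LinearMap.trace_id, finrank_tangentSpace]
  simp

/-- The hypothesis `hr` is needed because `pullback` inverts `dmap` only on its range. It is
discharged in `isUmbilicalAt_chart`. -/
theorem prodProj_dnormal (S : Hypersurface c₁ c₂ M) (hS : S.IsTotallyUmbilical) (x : M)
    (X : TangentSpace (𝓡 3) x)
    (hr : prodProj c₁ c₂ (S.map x) (S.dnormal x X) ∈ LinearMap.range (S.dmap x)) :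
    prodProj c₁ c₂ (S.map x) (S.dnormal x X) = -(S.meanCurvature x • S.dmap x X) := by
  obtain ⟨a, ha⟩ := hS x
  rw [S.meanCurvature_eq ha, ← S.dmap_pullback x hr]
  have h : -(S.pullback x (prodProj c₁ c₂ (S.map x) (S.dnormal x X))) = a • X :=
    LinearMap.congr_fun ha X
  rw [← map_smul, ← h, map_neg, neg_neg]

/-- The differential of a function is the derivative of its expression in the preferred chart. -/
theorem mfderiv_eq_fderiv_chart {W : Type*} [NormedAddCommGroup W] [NormedSpace ℝ W] {u : M → W}
    {x : M} (hu : MDifferentiableAt (𝓡 3) 𝓘(ℝ, W) u x) (X : TangentSpace (𝓡 3) x) :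
    mfderiv (𝓡 3) 𝓘(ℝ, W) u x X =
      fderiv ℝ (u ∘ (extChartAt (𝓡 3) x).symm) (extChartAt (𝓡 3) x x) X := by
  rw [hu.mfderiv, ModelWithCorners.range_eq_univ, fderivWithin_univ]
  rfl

/-- Differentiating a smooth function in a chart. -/
theorem fderiv_comp_extChartAt_symm [IsManifold (𝓡 3) ∞ M] {W : Type*} [NormedAddCommGroup W]
    [NormedSpace ℝ W] {u : M → W} (x : M) {z : EuclideanSpace ℝ (Fin 3)}
    (hz : z ∈ (extChartAt (𝓡 3) x).target)
    (hu : MDifferentiableAt (𝓡 3) 𝓘(ℝ, W) u ((extChartAt (𝓡 3) x).symm z)) :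
    fderiv ℝ (u ∘ (extChartAt (𝓡 3) x).symm) z =
      (mfderiv (𝓡 3) 𝓘(ℝ, W) u ((extChartAt (𝓡 3) x).symm z)).comp
        (mfderiv 𝓘(ℝ, EuclideanSpace ℝ (Fin 3)) (𝓡 3) (extChartAt (𝓡 3) x).symm z) := by
  have : IsManifold (𝓡 3) 1 M := .of_le (n := ∞) (by norm_num)
  have hs : MDifferentiableAt 𝓘(ℝ, EuclideanSpace ℝ (Fin 3)) (𝓡 3)
      (extChartAt (𝓡 3) x).symm z := by
    have := mdifferentiableWithinAt_extChartAt_symm (I := 𝓡 3) hz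
    rwa [ModelWithCorners.range_eq_univ, mdifferentiableWithinAt_univ] at this
  rw [← mfderiv_eq_fderiv, mfderiv_comp z hu hs]

/-- Away from the centre of the chart, coordinate vectors and tangent vectors are related by this
isomorphism. It carries injectivity of the differential over to coordinates. -/
theorem bijective_mfderiv_extChartAt_symm [IsManifold (𝓡 3) ∞ M] (x : M)
    {z : EuclideanSpace ℝ (Fin 3)} (hz : z ∈ (extChartAt (𝓡 3) x).target) :
    Function.Bijective
      (mfderiv 𝓘(ℝ, EuclideanSpace ℝ (Fin 3)) (𝓡 3) (extChartAt (𝓡 3) x).symm z) := by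
  have : IsManifold (𝓡 3) 1 M := .of_le (n := ∞) (by norm_num)
  have h := isInvertible_mfderivWithin_extChartAt_symm (I := 𝓡 3) hz
  rw [ModelWithCorners.range_eq_univ, mfderivWithin_univ] at h
  exact h.bijective

theorem contDiffAt_comp_extChartAt_symm [IsManifold (𝓡 3) ∞ M] {W : Type*} [NormedAddCommGroup W]
    [NormedSpace ℝ W] {u : M → W} (hu : ContMDiff (𝓡 3) 𝓘(ℝ, W) ∞ u) (x : M)
    {z : EuclideanSpace ℝ (Fin 3)} (hz : z ∈ (extChartAt (𝓡 3) x).target) :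
    ContDiffAt ℝ ∞ (u ∘ (extChartAt (𝓡 3) x).symm) z := by
  have h := hu.comp_contMDiffOn (contMDiffOn_extChartAt_symm (I := 𝓡 3) (n := ∞) x)
  exact (h.contMDiffAt ((isOpen_extChartAt_target x).mem_nhds hz)).contDiffAt

variable [IsManifold (𝓡 3) ∞ M]

theorem dmap_tangent (S : Hypersurface c₁ c₂ M) (x : M) (X : TangentSpace (𝓡 3) x) :
    (S.dmap x X).1 ∈ tangentPlane c₁ (S.map x).1 ∧
      (S.dmap x X).2 ∈ tangentPlane c₂ (S.map x).2 := by
  have h := fderiv_tangent ((contDiffAt_comp_extChartAt_symm S.map_smooth x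
    (mem_extChartAt_target x)).differentiableAt (by simp)) (.of_forall fun w => S.map_mem _) X
  rw [← mfderiv_eq_fderiv_chart (S.map_smooth.mdifferentiable (by simp) x), Function.comp_apply,
    extChartAt_to_inv] at h
  exact h

theorem isUmbilicalAt_chart (S : Hypersurface c₁ c₂ M) (hS : S.IsTotallyUmbilical) (x : M)
    {z : EuclideanSpace ℝ (Fin 3)} (hz : z ∈ (extChartAt (𝓡 3) x).target) :
    IsUmbilicalAt c₁ c₂ (S.map ∘ (extChartAt (𝓡 3) x).symm) (S.normal ∘ (extChartAt (𝓡 3) x).symm)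
      (S.meanCurvature ∘ (extChartAt (𝓡 3) x).symm) z := by
  have hbij := bijective_mfderiv_extChartAt_symm x hz
  set p := (extChartAt (𝓡 3) x).symm z with hp
  set T := mfderiv 𝓘(ℝ, EuclideanSpace ℝ (Fin 3)) (𝓡 3) (extChartAt (𝓡 3) x).symm z
  have hm2 : ∀ w ∈ (extChartAt (𝓡 3) x).target,
      ContDiffAt ℝ 2 (S.map ∘ (extChartAt (𝓡 3) x).symm) w := fun w hw =>
    (contDiffAt_comp_extChartAt_symm S.map_smooth x hw).of_le (by norm_cast)
  have hn2 : ∀ w ∈ (extChartAt (𝓡 3) x).target,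
      ContDiffAt ℝ 2 (S.normal ∘ (extChartAt (𝓡 3) x).symm) w := fun w hw =>
    (contDiffAt_comp_extChartAt_symm S.normal_smooth x hw).of_le (by norm_cast)
  have hdm : ∀ X, fderiv ℝ (S.map ∘ (extChartAt (𝓡 3) x).symm) z X = S.dmap p (T X) := fun X =>
    congrArg (fun L : EuclideanSpace ℝ (Fin 3) →L[ℝ] E3 × E3 => L X)
      (fderiv_comp_extChartAt_symm x hz (S.map_smooth.mdifferentiable (by simp) _))
  have hdn : ∀ X, fderiv ℝ (S.normal ∘ (extChartAt (𝓡 3) x).symm) z X = S.dnormal p (T X) :=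
    fun X => congrArg (fun L : EuclideanSpace ℝ (Fin 3) →L[ℝ] E3 × E3 => L X)
      (fderiv_comp_extChartAt_symm x hz (S.normal_smooth.mdifferentiable (by simp) _))
  have hmf := (hm2 z hz).differentiableAt two_ne_zero
  have hnf := (hn2 z hz).differentiableAt two_ne_zero
  have htan := S.dmap_tangent p
  refine ⟨hm2 z hz, hn2 z hz, S.map_mem _, ?_, S.normal_tangent _, S.normal_unit _, fun X => ?_,
    fun X => ?_⟩
  · intro X Y hXY
    rw [hdm, hdm] at hXY
    exact hbij.1 (S.dmap_injective p hXY)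
  · rw [hdm]
    exact S.normal_orthogonal p (T X)
  · have hpt : (prodProj c₁ c₂ (S.map p) (S.dnormal p (T X))).1 ∈ tangentPlane c₁ (S.map p).1 ∧
        (prodProj c₁ c₂ (S.map p) (S.dnormal p (T X))).2 ∈ tangentPlane c₂ (S.map p).2 :=
      ⟨tangentProj_mem (S.map_mem p).1 _, tangentProj_mem (S.map_mem p).2 _⟩
    -- Since `⟨ν, ν⟩ = 1`, the covariant derivative of `ν` is orthogonal to `ν`, hence tangent to
    -- the hypersurface.
    have hpo : prodMetric c₁ c₂ (prodProj c₁ c₂ (S.map p) (S.dnormal p (T X))) (S.normal p) = 0 := by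
      rw [← hdn]
      exact (prodMetric_prodProj_fderiv_normal hmf hnf (S.map_mem p)
        (.of_forall fun w => S.normal_tangent _) X (S.normal_tangent p)).trans
        (prodMetric_fderiv_normal_self hnf (.of_forall fun w => S.normal_unit _) X)
    rw [hdm, hdn]
    exact S.prodProj_dnormal hS p (T X) (mem_range_of_orthogonal (S.map_mem p) (S.normal_tangent p)
      (S.normal_unit p) (finrank_tangentSpace p) (S.dmap p) (S.dmap_injective p) htan
      (S.normal_orthogonal p) hpt hpo)

theorem eventually_isUmbilicalAt (S : Hypersurface c₁ c₂ M) (hS : S.IsTotallyUmbilical) (x : M) :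
    ∀ᶠ z in 𝓝 (extChartAt (𝓡 3) x x),
      IsUmbilicalAt c₁ c₂ (S.map ∘ (extChartAt (𝓡 3) x).symm)
        (S.normal ∘ (extChartAt (𝓡 3) x).symm) (S.meanCurvature ∘ (extChartAt (𝓡 3) x).symm) z := by
  filter_upwards [(isOpen_extChartAt_target (I := 𝓡 3) x).mem_nhds (mem_extChartAt_target x)]
    with z hz using S.isUmbilicalAt_chart hS x hz

theorem mdifferentiable_meanCurvature (S : Hypersurface c₁ c₂ M) (hS : S.IsTotallyUmbilical) :
    MDifferentiable (𝓡 3) 𝓘(ℝ, ℝ) S.meanCurvature := fun x => by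
  have : IsManifold (𝓡 3) 1 M := .of_le (n := ∞) (by norm_num)
  have h := IsUmbilicalAt.differentiableAt (S.eventually_isUmbilicalAt hS x)
  have hc := h.mdifferentiableAt.comp x
    (mdifferentiableAt_extChartAt (I := 𝓡 3) (mem_chart_source _ x))
  refine hc.congr_of_eventuallyEq ?_
  filter_upwards [extChartAt_source_mem_nhds (I := 𝓡 3) x] with y hy
  simp only [Function.comp_apply, (extChartAt (𝓡 3) x).left_inv hy]

/-! ### The field `V`, its dual one-form and the norms -/

theorem dmap_V (S : Hypersurface c₁ c₂ M) (x : M) :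
    S.dmap x (S.V x) = prodStructure (S.normal x) - S.h x • S.normal x := by
  have hn := S.normal_tangent x
  refine S.dmap_pullback x (mem_range_of_orthogonal (S.map_mem x) hn (S.normal_unit x)
    (finrank_tangentSpace x) (S.dmap x) (S.dmap_injective x) (S.dmap_tangent x)
    (S.normal_orthogonal x) ⟨?_, ?_⟩ ?_)
  · exact sub_mem hn.1 (Submodule.smul_mem _ _ hn.1)
  · exact sub_mem (neg_mem hn.2) (Submodule.smul_mem _ _ hn.2)
  · rw [map_sub, map_smul, LinearMap.sub_apply, LinearMap.smul_apply, S.normal_unit, h, smul_eq_mul,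
      mul_one, sub_self]

theorem metric_V (S : Hypersurface c₁ c₂ M) (x : M) (X : TangentSpace (𝓡 3) x) :
    S.metric x X (S.V x) = prodMetric c₁ c₂ (S.dmap x X) (prodStructure (S.normal x)) := by
  change prodMetric c₁ c₂ (S.dmap x X) (S.dmap x (S.V x)) = _
  have h : prodMetric c₁ c₂ (S.dmap x X) (S.normal x) = 0 := S.normal_orthogonal x X
  rw [dmap_V, map_sub, map_smul, h, smul_zero, sub_zero]

/-- On a totally umbilical hypersurface, `dH` is a multiple of the one-form dual to `V`. -/
theorem differential_meanCurvature (S : Hypersurface c₁ c₂ M) (hS : S.IsTotallyUmbilical) (x : M)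
    (X : TangentSpace (𝓡 3) x) :
    differential S.meanCurvature x X = (c₁ - c₂) / 4 * S.metric x X (S.V x) := by
  have h := IsUmbilicalAt.fderiv_eq finrank_euclideanSpace_fin
    (S.eventually_isUmbilicalAt hS x) X
  rw [← mfderiv_eq_fderiv_chart (S.mdifferentiable_meanCurvature hS x),
    ← mfderiv_eq_fderiv_chart (S.map_smooth.mdifferentiable (by simp) x), Function.comp_apply,
    extChartAt_to_inv] at h
  rw [metric_V]
  exact h

theorem metric_nonneg (S : Hypersurface c₁ c₂ M) (x : M) (X : TangentSpace (𝓡 3) x) :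
    0 ≤ S.metric x X X :=
  add_nonneg (form_nonneg (S.map_mem x).1 (S.dmap_tangent x X).1)
    (form_nonneg (S.map_mem x).2 (S.dmap_tangent x X).2)

theorem abs_metric_le (S : Hypersurface c₁ c₂ M) (x : M) (X Y : TangentSpace (𝓡 3) x) :
    |S.metric x X Y| ≤ S.tangentNorm x X * S.tangentNorm x Y := by
  rw [tangentNorm, tangentNorm, ← Real.sqrt_mul (S.metric_nonneg x X)]
  refine Real.abs_le_sqrt ?_
  exact LinearMap.BilinForm.apply_sq_le_of_symm (S.metric x) (S.metric_nonneg x)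
    ⟨fun Y Z => prodMetric_comm ..⟩ X Y

/-- The norm of the one-form dual to a multiple of a tangent vector. -/
theorem diffNorm_eq (S : Hypersurface c₁ c₂ M) {u : M → ℝ} {x : M} {k : ℝ}
    {W : TangentSpace (𝓡 3) x} (hu : ∀ X, differential u x X = k * S.metric x X W) :
    S.diffNorm u x = |k| * S.tangentNorm x W := by
  refine IsGreatest.csSup_eq ⟨?_, ?_⟩
  · have hsq : S.tangentNorm x W * S.tangentNorm x W = S.metric x W W :=
      Real.mul_self_sqrt (S.metric_nonneg x W)
    -- The supremum is attained at `W / ‖W‖`, or at `0` when `‖W‖ = 0`; the upper bound is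
    -- Cauchy–Schwarz.
    by_cases h0 : S.tangentNorm x W = 0
    · exact ⟨0, by simp [tangentNorm], by simp [h0]⟩
    · refine ⟨(S.tangentNorm x W)⁻¹ • W, ?_, ?_⟩
      · rw [tangentNorm]
        simp only [map_smul, LinearMap.smul_apply, smul_eq_mul]
        rw [← hsq]
        field_simp
        simp
      · rw [hu, map_smul, LinearMap.smul_apply, smul_eq_mul, ← hsq, inv_mul_cancel_left₀ h0, abs_mul,
          abs_of_nonneg (show 0 ≤ S.tangentNorm x W from Real.sqrt_nonneg _)]
  · rintro _ ⟨X, hX, rfl⟩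
    rw [hu, abs_mul]
    refine mul_le_mul_of_nonneg_left ((S.abs_metric_le x X W).trans ?_) (abs_nonneg k)
    exact mul_le_of_le_one_left (Real.sqrt_nonneg _) hX

end Hypersurface

end ProductHypersurface

theorem lemma4p1 (c₁ c₂ : ℝ) {M : Type*} [TopologicalSpace M]
    [ChartedSpace (EuclideanSpace ℝ (Fin 3)) M] [IsManifold (𝓡 3) ∞ M]
    (S : ProductHypersurface.Hypersurface c₁ c₂ M) (hS : S.IsTotallyUmbilical) :
    MDifferentiable (𝓡 3) 𝓘(ℝ, ℝ) S.meanCurvature ∧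
      ∀ x : M, S.tangentNorm x (S.V x) * |c₁ - c₂| = 4 * S.diffNorm S.meanCurvature x := by
  refine ⟨S.mdifferentiable_meanCurvature hS, fun x => ?_⟩
  rw [S.diffNorm_eq (S.differential_meanCurvature hS x), abs_div, abs_of_pos (four_pos (α := ℝ))]
  ring
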